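/- **Conventions.** An mm-space $(X,\mu,d)$ is a complete separable metric space $(X,d)$ with a Borel probability measure $\mu$. Let $\lambda$ be Lebesgue measure on $[0,1)$. A parameter of $X$ is a Borel map $\varphi:[0,1)\to X$ with $\varphi_*\lambda=\mu$. For functions $u,v:[0,1)\to\mathbb R$ put $\mathrm{me}_\lambda(u,v)=\inf\{\varepsilon>0:\lambda(|u-v|>\varepsilon)\le\varepsilon\}$. The observable distance is $$d_{conc}(X,Y)=\inf_{\varphi,\psi}\,(\mathrm{me}_\lambda)_H\big(\mathrm{Lip}_1(X)\circ\varphi,\ \mathrm{Lip}_1(Y)\circ\psi\big),$$ where $\varphi,\psi$ run over the parameters of $X$ and $Y$, $\mathrm{Lip}_1$ is the set of real $1$-Lipschitz functions, and $(\mathrm{me}_\lambda)_H$ is the Hausdorff distance associated with $\mathrm{me}_\lambda$. A sequence of mm-spaces $X_n$ $d_{conc}$-converges to $X$ if $d_{conc}(X_n,X)\to0$. **Setting.** For $n\in\mathbb N$ let $N_n$ be a complete separable smooth Riemannian manifold (of any finite dimension), with geodesic distance $g_n$ and with $\mu_n$ its Riemannian volume measure normalized to total mass $1$. Let $M_n\subsetneq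 N_n$ be a (smoothly embedded) submanifold, closed as a subset. Let $\mathrm{proj}_n:N_n\to M_n$ be a ($\mu_n$-measurable) nearest-point projection, that is, $g_n(x,\mathrm{proj}_n(x))=g_n(x,M_n)$ for all $x\in N_n$. Equip $M_n$ with the measure $\sigma_n=(\mathrm{proj}_n)_*\mu_n$ and with the distance $g'_n=g_n|_{M_n}$ (the restriction of $g_n$ to $M_n\times M_n$). The sequence $(M_n)$ is a concentration locus for $(N_n)$ if there are $\varepsilon_n>0$ with $\varepsilon_n\to0$ and $$\mu_n\big(N_n\setminus\{x: g_n(x,M_n)<\varepsilon_n\}\big)\to0 .$$ **Corollary.** Suppose that for some $h\in\mathbb R$ the Riemannian volumes and the diameters of all the $N_n$ are at most $h$, and that $(M_n)$ is a concentration locus for $(N_n)$. Let $(M,\sigma,g')$ be an mm-space. If $(M_n,\sigma_n,g'_n)$ $d_{conc}$-converges to $(M,\sigma,g')$, then $(N_n,\mu_n,g_n)$ $d_{conc}$-converges to $(M,\sigma,g')$. -/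

import Mathlib

open MeasureTheory Set Filter Topology Manifold Bundle
open scoped ENNReal ContDiff

noncomputable section

/-! ### The observable distance between metric measure spaces -/

/-- The unit interval `[0, 1)`. -/
abbrev UnitIco : Type := Set.Ico (0 : ℝ) 1

/-- Lebesgue measure on `[0, 1)`. -/
def unitLebesgue : Measure UnitIco := Measure.comap (fun s : UnitIco => (s : ℝ)) volume

/-- The distance in measure `me_λ` on real functions on `[0, 1)`:
the infimum of the `ε > 0` with `λ {s | |f s - g s| > ε} ≤ ε`. -/
def meDist (f g : UnitIco → ℝ) : ℝ≥0∞ :=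
  sInf {ε : ℝ≥0∞ | 0 < ε ∧ unitLebesgue {s : UnitIco | ε < edist (f s) (g s)} ≤ ε}

/-- The Hausdorff distance, with respect to `me_λ`, of two sets of functions on `[0, 1)`. -/
def meHausdorffDist (A B : Set (UnitIco → ℝ)) : ℝ≥0∞ :=
  sInf {ε : ℝ≥0∞ | 0 < ε ∧ (∀ g ∈ B, ∃ f ∈ A, meDist f g < ε) ∧ (∀ f ∈ A, ∃ g ∈ B, meDist f g < ε)}

/-- A parameter (parametrization) of `(X, μ)`: a Borel map `φ : [0, 1) → X` with `φ_* λ = μ`. -/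
def IsParameter {X : Type*} [MeasurableSpace X] (φ : UnitIco → X) (μ : Measure X) : Prop :=
  Measurable φ ∧ Measure.map φ unitLebesgue = μ

/-- The set `Lip₁(X) ∘ φ` of all `f ∘ φ` with `f : X → ℝ` a `1`-Lipschitz function. -/
def lipComp {X : Type*} [MetricSpace X] (φ : UnitIco → X) : Set (UnitIco → ℝ) :=
  {u | ∃ f : X → ℝ, LipschitzWith 1 f ∧ u = f ∘ φ}

/-- The observable distance `d_conc` of the mm-spaces `(X, μ)` and `(Y, ν)`. -/
def dConc {X Y : Type*} [MetricSpace X] [MeasurableSpace X] [MetricSpace Y] [MeasurableSpace Y]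
    (μ : Measure X) (ν : Measure Y) : ℝ≥0∞ :=
  ⨅ (φ : UnitIco → X) (_ : IsParameter φ μ) (ψ : UnitIco → Y) (_ : IsParameter ψ ν),
    meHausdorffDist (lipComp φ) (lipComp ψ)

/-! ### Concentration loci and projections -/

/-- `S n ⊆ X n` is a concentration locus for `(X n, μ n)`: the `S n` are proper closed subsets and,
for some radii `ε n > 0` tending to `0`, the measures of the complements of the tubular
neighbourhoods `{x | d(x, S n) < ε n}` tend to `0`. -/
def IsConcentrationLocus {X : ℕ → Type*} [∀ n, MetricSpace (X n)] [∀ n, MeasurableSpace (X n)]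
    (μ : ∀ n, Measure (X n)) (S : ∀ n, Set (X n)) : Prop :=
  (∀ n, IsClosed (S n) ∧ S n ≠ univ) ∧
  ∃ ε : ℕ → ℝ, (∀ n, 0 < ε n) ∧ Tendsto ε atTop (𝓝 0) ∧
    Tendsto (fun n => μ n (univ \ Metric.thickening (ε n) (S n))) atTop (𝓝 0)

/-- `p : X → S` is a nearest-point projection onto `S`: `d(x, p x) = d(x, S)` for all `x`. -/
def IsNearestPointProjection {X : Type*} [MetricSpace X] {S : Set X} (p : X → S) : Prop :=
  ∀ x, dist x (p x : X) = Metric.infDist x S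

/-! ### Submanifolds and the volume measure of a Riemannian manifold -/

/-- `S` is a smooth (embedded, boundaryless) submanifold of the `d`-manifold `N`: it is the image
of a smooth embedding of some smooth manifold. -/
def IsEmbeddedSubmanifold.{u} (d : ℕ) {N : Type u} [TopologicalSpace N]
    [ChartedSpace (EuclideanSpace ℝ (Fin d)) N] (S : Set N) : Prop :=
  ∃ (k : ℕ) (P : Type u) (_ : TopologicalSpace P) (_ : ChartedSpace (EuclideanSpace ℝ (Fin k)) P)
    (_ : IsManifold (𝓡 k) ∞ P) (ι : P → N), IsSmoothEmbedding (𝓡 k) (𝓡 d) ∞ ι ∧ range ι = S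

section Volume

variable (d : ℕ) {N : Type*} [TopologicalSpace N] [ChartedSpace (EuclideanSpace ℝ (Fin d)) N]
  [RiemannianBundle (fun x : N => TangentSpace (𝓡 d) x)]

/-- The `i`-th coordinate vector field `∂ᵢ` of the chart `φ`, at the point with coordinates `y`. -/
def coordVector (φ : OpenPartialHomeomorph N (EuclideanSpace ℝ (Fin d)))
    (y : EuclideanSpace ℝ (Fin d)) (i : Fin d) : TangentSpace (𝓡 d) (φ.symm y) :=
  mfderiv (𝓡 d) (𝓡 d) φ.symm y (EuclideanSpace.single i (1 : ℝ))

/-- The matrix `gᵢⱼ = g(∂ᵢ, ∂ⱼ)` of the Riemannian metric in the chart `φ`. -/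
def gramMatrix (φ : OpenPartialHomeomorph N (EuclideanSpace ℝ (Fin d)))
    (y : EuclideanSpace ℝ (Fin d)) : Matrix (Fin d) (Fin d) ℝ :=
  Matrix.of fun i j => inner ℝ (coordVector d φ y i) (coordVector d φ y j)

variable [MeasurableSpace N]

/-- The Riemannian volume on the domain of the chart `φ`: the measure `√(det gᵢⱼ) dy` on the image
of `φ`, transported to `N`. -/
def chartVolume (φ : OpenPartialHomeomorph N (EuclideanSpace ℝ (Fin d))) : Measure N :=
  Measure.map φ.symm ((volume.restrict φ.target).withDensity
    fun y => ENNReal.ofReal (Real.sqrt (gramMatrix d φ y).det))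

variable (N) in
/-- The Riemannian volume measure of `N`, glued from the volumes of the charts: these agree on
overlaps, so that their supremum in the lattice of measures is the measure
which restricts to `chartVolume d φ` on the domain of each chart `φ`. -/
def riemannianVolume : Measure N :=
  ⨆ φ ∈ atlas (EuclideanSpace ℝ (Fin d)) N, chartVolume d φ

variable (N) in
/-- The Riemannian volume measure normalized to total mass one. -/
def normalizedVolume : Measure N :=
  (riemannianVolume d N univ)⁻¹ • riemannianVolume d N

end Volume

end

/-!
The projections `proj n` turn the concentration hypothesis into the statement that `N n` and `M n`
are close in the observable distance: a `1`-Lipschitz function on `N n` and its restriction to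
`M n`, precomposed with the projection, differ by less than `ε n` on the tubular neighbourhood of
radius `ε n`, and every `1`-Lipschitz function on `M n` arises as such a restriction by McShane's
extension theorem.

To combine this with the convergence of the `M n`, a parameter `φ` of `M n`, chosen for its
comparison with the limit space, has to be lifted to `N n`. In general there is no parameter `χ` of
`N n` with `proj n ∘ χ = φ`, because `φ` may be injective while the fibres of the projection carry
mass. The lift exists after reparametrizing: `exists_ae_fiberProduct_coupling` couples the measure
of `N n` with Lebesgue measure along the fibre product of `proj n` and `φ`, by disintegrating
Lebesgue measure over `φ`, and a parameter of this coupling consists of a parameter `χ` of `N n` and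
a measure preserving `τ : [0, 1) → [0, 1)` with `proj n ∘ χ = φ ∘ τ` almost everywhere. Precomposing
with `τ` does not change `me_λ`. This yields `dConc_le_dConc_map_add`, which bounds the observable
distance of `N n` from any space by that of `M n` plus an error tending to `0`.

That the normalized volume has total mass one need not be proved separately: a measure with a
parameter is a probability measure, and finite observable distance forces parameters to exist.
-/

open ProbabilityTheory

/-! ### Parameters of probability measures -/

instance isProbabilityMeasure_unitLebesgue : IsProbabilityMeasure unitLebesgue where
  measure_univ := by
    rw [unitLebesgue, (MeasurableEmbedding.subtype_coe measurableSet_Ico).comap_apply]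
    rw [image_univ, Subtype.range_coe, Real.volume_Ico]
    simp

/-- Including `[0, 1)` into `[0, 1]` preserves Lebesgue measure. -/
theorem map_inclusion_unitLebesgue :
    Measure.map (Set.inclusion Ico_subset_Icc_self : UnitIco → unitInterval) unitLebesgue
      = volume := by
  have hcoe := unitInterval.measurableEmbedding_coe
  have hincl : Measurable (Set.inclusion Ico_subset_Icc_self : UnitIco → unitInterval) :=
    measurable_inclusion _
  rw [← hcoe.comap_map (Measure.map _ unitLebesgue), ← hcoe.comap_map volume,
    unitInterval.measurePreserving_coe.map_eq, Measure.map_map hcoe.measurable hincl]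
  congr 1
  change Measure.map (fun s : UnitIco => (s : ℝ)) unitLebesgue = _
  rw [unitLebesgue, (MeasurableEmbedding.subtype_coe measurableSet_Ico).map_comap,
    Subtype.range_coe]
  exact restrict_Ico_eq_restrict_Icc

theorem IsParameter.isProbabilityMeasure {X : Type*} [MeasurableSpace X] {φ : UnitIco → X}
    {μ : Measure X} (hφ : IsParameter φ μ) : IsProbabilityMeasure μ := by
  rw [← hφ.2]
  exact Measure.isProbabilityMeasure_map hφ.1.aemeasurable

theorem exists_isParameter {X : Type*} [MeasurableSpace X] [StandardBorelSpace X]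
    (μ : Measure X) [IsProbabilityMeasure μ] : ∃ φ : UnitIco → X, IsParameter φ μ := by
  have : Nonempty X := nonempty_of_isProbabilityMeasure μ
  obtain ⟨f, hf, hfμ⟩ := μ.exists_measurable_map_eq
  have hincl : Measurable (Set.inclusion Ico_subset_Icc_self : UnitIco → unitInterval) :=
    measurable_inclusion _
  exact ⟨f ∘ Set.inclusion Ico_subset_Icc_self, hf.comp hincl, by
    rw [← Measure.map_map hf hincl, map_inclusion_unitLebesgue, hfμ]⟩

/-! ### Couplings along a fibre product -/

/-- If `p` and `f` push `μ` and `ν` to the same measure, then some coupling of `μ` and `ν` is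
concentrated on the fibre product `{(x, t) | p x = f t}`. It is the composition of `μ` with the
conditional distribution of `t` given `f t = p x`. -/
theorem exists_fiberProduct_coupling {X Y T : Type*} [MeasurableSpace X] [MeasurableSpace Y]
    [MeasurableEq Y] [MeasurableSpace T] [StandardBorelSpace T] (μ : Measure X)
    [IsProbabilityMeasure μ] (ν : Measure T) [IsProbabilityMeasure ν] {p : X → Y} {f : T → Y}
    (hp : Measurable p) (hf : Measurable f) (h : Measure.map p μ = Measure.map f ν) :
    ∃ ρ : Measure (X × T), IsProbabilityMeasure ρ ∧ Measure.map Prod.fst ρ = μ ∧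
      Measure.map Prod.snd ρ = ν ∧ ∀ᵐ z ∂ρ, p z.1 = f z.2 := by
  have : Nonempty T := nonempty_of_isProbabilityMeasure ν
  set κ : Kernel Y T := condDistrib id f ν
  have hκ : Measure.map f ν ⊗ₘ κ = Measure.map (fun t => (f t, t)) ν :=
    compProd_map_condDistrib aemeasurable_id
  refine ⟨μ ⊗ₘ κ.comap p hp, inferInstance, ?_, ?_, ?_⟩
  · exact Measure.fst_compProd _ _
  · ext s hs
    calc Measure.map Prod.snd (μ ⊗ₘ κ.comap p hp) s = ∫⁻ x, κ (p x) s ∂μ := by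
          rw [Measure.map_apply measurable_snd hs, Measure.compProd_apply (measurable_snd hs)]
          rfl
      _ = ∫⁻ y, κ y s ∂(Measure.map f ν) := by
          rw [← h, lintegral_map (κ.measurable_coe hs) hp]
      _ = (Measure.map f ν ⊗ₘ κ) (Prod.snd ⁻¹' s) := by
          rw [Measure.compProd_apply (measurable_snd hs)]
          rfl
      _ = ν s := by
          rw [hκ, Measure.map_apply (by fun_prop) (measurable_snd hs)]
          rfl
  · have hgraph : ∀ᵐ q ∂(Measure.map f ν ⊗ₘ κ), q.1 = f q.2 := by
      rw [hκ]
      refine (ae_map_iff (by fun_prop) (measurableSet_eq_fun measurable_fst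
        (hf.comp measurable_snd))).2 (ae_of_all _ fun _ => rfl)
    have hfib := Measure.ae_ae_of_ae_compProd hgraph
    rw [← h] at hfib
    exact Measure.ae_compProd_of_ae_ae
      (measurableSet_eq_fun (hp.comp measurable_fst) (hf.comp measurable_snd))
      (ae_of_ae_map hp.aemeasurable hfib)

/-- The version of `exists_fiberProduct_coupling` for an almost everywhere measurable `p`. -/
theorem exists_ae_fiberProduct_coupling {X Y T : Type*} [MeasurableSpace X] [MeasurableSpace Y]
    [MeasurableEq Y] [MeasurableSpace T] [StandardBorelSpace T] (μ : Measure X)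
    [IsProbabilityMeasure μ] (ν : Measure T) [IsProbabilityMeasure ν] {p : X → Y} {f : T → Y}
    (hp : AEMeasurable p μ) (hf : Measurable f) (h : Measure.map p μ = Measure.map f ν) :
    ∃ ρ : Measure (X × T), IsProbabilityMeasure ρ ∧ Measure.map Prod.fst ρ = μ ∧
      Measure.map Prod.snd ρ = ν ∧ ∀ᵐ z ∂ρ, p z.1 = f z.2 := by
  obtain ⟨ρ, hρ, hfst, hsnd, hae⟩ := exists_fiberProduct_coupling μ ν hp.measurable_mk hf
    ((Measure.map_congr hp.ae_eq_mk).symm.trans h)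
  refine ⟨ρ, hρ, hfst, hsnd, ?_⟩
  have hmk : ∀ᵐ x ∂(Measure.map Prod.fst ρ), p x = hp.mk p x := hfst.symm ▸ hp.ae_eq_mk
  filter_upwards [hae, ae_of_ae_map measurable_fst.aemeasurable hmk] with z hz hz'
  exact hz'.trans hz

/-- Lifting of parameters: a parameter `φ` of `p_* μ` lifts along `p` to a parameter `χ` of `μ`,
up to a measure preserving reparametrization `τ` of `[0, 1)`. -/
theorem IsParameter.exists_lift {X Y : Type*} [MeasurableSpace X] [StandardBorelSpace X]
    [MeasurableSpace Y] [MeasurableEq Y] {μ : Measure X} {p : X → Y} (hp : AEMeasurable p μ)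
    {φ : UnitIco → Y} (hφ : IsParameter φ (Measure.map p μ)) :
    ∃ (χ : UnitIco → X) (τ : UnitIco → UnitIco), IsParameter χ μ ∧
      MeasurePreserving τ unitLebesgue unitLebesgue ∧
      ∀ᵐ s ∂unitLebesgue, p (χ s) = φ (τ s) := by
  have : IsProbabilityMeasure (Measure.map p μ) := hφ.isProbabilityMeasure
  have : IsProbabilityMeasure μ := Measure.isProbabilityMeasure_of_map p
  have : StandardBorelSpace UnitIco := measurableSet_Ico.standardBorel
  obtain ⟨ρ, hρ, hfst, hsnd, hae⟩ :=
    exists_ae_fiberProduct_coupling μ unitLebesgue hp hφ.1 hφ.2.symm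
  obtain ⟨θ, hθ, rfl⟩ := exists_isParameter ρ
  refine ⟨fun s => (θ s).1, fun s => (θ s).2, ⟨hθ.fst, ?_⟩, ⟨hθ.snd, ?_⟩,
    ae_of_ae_map hθ.aemeasurable hae⟩
  · rw [← hfst, Measure.map_map measurable_fst hθ]
    rfl
  · rw [Measure.map_map measurable_snd hθ] at hsnd
    exact hsnd

/-! ### The distance in measure -/

theorem meDist_comm (f g : UnitIco → ℝ) : meDist f g = meDist g f := by
  simp only [meDist, edist_comm]

theorem meDist_le {f g : UnitIco → ℝ} {ε : ℝ≥0∞} (hε : 0 < ε)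
    (h : unitLebesgue {s | ε < edist (f s) (g s)} ≤ ε) : meDist f g ≤ ε :=
  sInf_le ⟨hε, h⟩

theorem meDist_triangle (f g h : UnitIco → ℝ) : meDist f h ≤ meDist f g + meDist g h := by
  refine ENNReal.le_of_forall_pos_le_add fun δ hδ hfin => ?_
  have hδ' : (δ / 2 : ℝ≥0∞) ≠ 0 := by simpa using hδ.ne'
  obtain ⟨hfin₁, hfin₂⟩ := ENNReal.add_lt_top.1 hfin
  obtain ⟨a, ⟨ha, hfa⟩, ha'⟩ := sInf_lt_iff.1 (ENNReal.lt_add_right hfin₁.ne hδ')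
  obtain ⟨b, ⟨-, hgb⟩, hb'⟩ := sInf_lt_iff.1 (ENNReal.lt_add_right hfin₂.ne hδ')
  have hab : meDist f h ≤ a + b := by
    refine meDist_le (ha.trans_le le_self_add) ?_
    calc unitLebesgue {s | a + b < edist (f s) (h s)}
        ≤ unitLebesgue ({s | a < edist (f s) (g s)} ∪ {s | b < edist (g s) (h s)}) := by
          refine measure_mono fun s hs => ?_
          by_contra hcon
          simp only [mem_union, mem_ofPred_eq, not_or, not_lt] at hcon hs
          exact hs.not_ge ((edist_triangle _ _ _).trans (add_le_add hcon.1 hcon.2))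
      _ ≤ a + b := (measure_union_le _ _).trans (add_le_add hfa hgb)
  calc meDist f h ≤ a + b := hab
    _ ≤ (meDist f g + δ / 2) + (meDist g h + δ / 2) := add_le_add ha'.le hb'.le
    _ = meDist f g + meDist g h + δ := by rw [add_add_add_comm, ENNReal.add_halves]

theorem meDist_comp_of_measurePreserving {f g : UnitIco → ℝ} (hf : Measurable f)
    (hg : Measurable g) {τ : UnitIco → UnitIco}
    (hτ : MeasurePreserving τ unitLebesgue unitLebesgue) :
    meDist (f ∘ τ) (g ∘ τ) = meDist f g := by
  have h (ε : ℝ≥0∞) : unitLebesgue {s | ε < edist ((f ∘ τ) s) ((g ∘ τ) s)}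
      = unitLebesgue {s | ε < edist (f s) (g s)} :=
    hτ.measure_preimage
      (measurableSet_lt measurable_const (hf.edist hg)).nullMeasurableSet
  simp only [meDist, h]

/-! ### Observable distance and nearest-point projections -/

theorem measurable_of_mem_lipComp {X : Type*} [MetricSpace X] [MeasurableSpace X] [BorelSpace X]
    {φ : UnitIco → X} (hφ : Measurable φ) {u : UnitIco → ℝ} (hu : u ∈ lipComp φ) :
    Measurable u := by
  obtain ⟨f, hf, rfl⟩ := hu
  exact hf.continuous.measurable.comp hφ

/-- If two families of functions `A` and `A'` are such that each `u ∈ A` has a reparametrization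
`u ∘ τ` that is `η`-close to a member of `A'` and conversely, then the Hausdorff distance from
`A'` to `B ∘ τ` exceeds that from `A` to `B` by at most `η`. -/
theorem meHausdorffDist_le_add {A A' B B' : Set (UnitIco → ℝ)} {τ : UnitIco → UnitIco}
    (hτ : MeasurePreserving τ unitLebesgue unitLebesgue) (hA : ∀ u ∈ A, Measurable u)
    (hB : ∀ v ∈ B, Measurable v) (hB' : B' = (fun v => v ∘ τ) '' B) {η : ℝ≥0∞}
    (h₁ : ∀ u ∈ A, ∃ u' ∈ A', meDist u' (u ∘ τ) ≤ η)
    (h₂ : ∀ u' ∈ A', ∃ u ∈ A, meDist u' (u ∘ τ) ≤ η) :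
    meHausdorffDist A' B' ≤ meHausdorffDist A B + η := by
  subst hB'
  obtain rfl | hη := eq_or_ne η ⊤
  · simp
  have key {u u' v : UnitIco → ℝ} {c : ℝ≥0∞} (hu : u ∈ A) (hv : v ∈ B)
      (hu' : meDist u' (u ∘ τ) ≤ η) (huv : meDist u v < c) : meDist u' (v ∘ τ) < c + η :=
    calc meDist u' (v ∘ τ) ≤ meDist u' (u ∘ τ) + meDist (u ∘ τ) (v ∘ τ) := meDist_triangle _ _ _
      _ = meDist u v + meDist u' (u ∘ τ) := by
        rw [meDist_comp_of_measurePreserving (hA u hu) (hB v hv) hτ, add_comm]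
      _ < c + η := by
        rw [add_comm, add_comm c]
        exact ENNReal.add_lt_add_of_le_of_lt (ne_top_of_le_ne_top hη hu') hu' huv
  rw [← tsub_le_iff_right]
  refine le_sInf fun c ⟨hc, hBA, hAB⟩ => ?_
  rw [tsub_le_iff_right]
  refine sInf_le ⟨hc.trans_le le_self_add, ?_, ?_⟩
  · rintro _ ⟨v, hv, rfl⟩
    obtain ⟨u, hu, huv⟩ := hBA v hv
    obtain ⟨u', hu', huu'⟩ := h₁ u hu
    exact ⟨u', hu', key hu hv huu' huv⟩
  · intro u' hu'
    obtain ⟨u, hu, huu'⟩ := h₂ u' hu'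
    obtain ⟨v, hv, huv⟩ := hAB u hu
    exact ⟨v ∘ τ, ⟨v, hv, rfl⟩, key hu hv huu' huv⟩

theorem lipComp_comp {X : Type*} [MetricSpace X] (φ : UnitIco → X) (τ : UnitIco → UnitIco) :
    lipComp (φ ∘ τ) = (fun u => u ∘ τ) '' lipComp φ := by
  ext u
  constructor
  · rintro ⟨f, hf, rfl⟩
    exact ⟨f ∘ φ, ⟨f, hf, rfl⟩, rfl⟩
  · rintro ⟨_, ⟨f, hf, rfl⟩, rfl⟩
    exact ⟨f, hf, rfl⟩

theorem IsNearestPointProjection.edist_lt {X : Type*} [MetricSpace X] {S : Set X} {p : X → S}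
    (hp : IsNearestPointProjection p) {ε : ℝ} {x : X} (hx : x ∈ Metric.thickening ε S) :
    edist x (p x : X) < ENNReal.ofReal ε := by
  have hS : S.Nonempty := ⟨_, (p x).2⟩
  rw [Metric.mem_thickening_iff_infEDist_lt, ← ENNReal.ofReal_toReal
    (Metric.infEDist_ne_top hS (x := x))] at hx
  rw [edist_dist, hp x]
  exact hx

/-- A `1`-Lipschitz function and its value at the projected point are close in measure, if `μ` is
concentrated near `S`. -/
theorem meDist_comp_le_of_lift {X : Type*} [MetricSpace X] [MeasurableSpace X] [BorelSpace X]
    {S : Set X} {μ : Measure X} {p : X → S} (hp : IsNearestPointProjection p)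
    {χ : UnitIco → X} (hχ : IsParameter χ μ) {ξ : UnitIco → S}
    (hξ : ∀ᵐ s ∂unitLebesgue, p (χ s) = ξ s) {ε : ℝ} {η : ℝ≥0∞} (hη : 0 < η)
    (hεη : ENNReal.ofReal ε ≤ η) (hμ : μ (univ \ Metric.thickening ε S) ≤ η)
    {f : X → ℝ} (hf : LipschitzWith 1 f) :
    meDist (f ∘ χ) (fun s => f (ξ s)) ≤ η := by
  refine meDist_le hη ?_
  calc unitLebesgue {s | η < edist ((f ∘ χ) s) (f (ξ s))}
      ≤ unitLebesgue (χ ⁻¹' (univ \ Metric.thickening ε S)) := by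
        refine measure_mono_ae ?_
        filter_upwards [hξ] with s hs hlt
        refine ⟨trivial, fun hmem => ?_⟩
        refine (lt_of_lt_of_le hlt ?_).false
        have hfs : edist (f (χ s)) (f (ξ s)) ≤ edist (χ s) (ξ s : X) := by
          simpa using hf (χ s) (ξ s)
        rw [← hs] at hfs ⊢
        exact hfs.trans ((hp.edist_lt hmem).le.trans hεη)
    _ = μ (univ \ Metric.thickening ε S) := by
        rw [← hχ.2, Measure.map_apply hχ.1
          (MeasurableSet.univ.diff Metric.isOpen_thickening.measurableSet)]
    _ ≤ η := hμ

/-- If `μ` is concentrated near `S`, its observable distance from any space exceeds that of its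
nearest-point projection to `S` by a small amount at most. -/
theorem dConc_le_dConc_map_add {X Y : Type*} [MetricSpace X] [SecondCountableTopology X]
    [MeasurableSpace X] [BorelSpace X] [StandardBorelSpace X] [MetricSpace Y] [MeasurableSpace Y]
    [BorelSpace Y] {S : Set X} {μ : Measure X} (ν : Measure Y) {p : X → S}
    (hp : IsNearestPointProjection p) (hpm : AEMeasurable p μ) {ε : ℝ} {η : ℝ≥0∞} (hη : 0 < η)
    (hεη : ENNReal.ofReal ε ≤ η) (hμ : μ (univ \ Metric.thickening ε S) ≤ η) :
    dConc μ ν ≤ dConc (Measure.map p μ) ν + η := by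
  rw [← tsub_le_iff_right]
  refine le_iInf₂ fun φ hφ => le_iInf₂ fun ψ hψ => ?_
  rw [tsub_le_iff_right]
  obtain ⟨χ, τ, hχ, hτ, hlift⟩ := hφ.exists_lift hpm
  have hψτ : IsParameter (ψ ∘ τ) ν :=
    ⟨hψ.1.comp hτ.measurable, by rw [← Measure.map_map hψ.1 hτ.measurable, hτ.map_eq, hψ.2]⟩
  refine (iInf₂_le_of_le χ hχ (iInf₂_le (ψ ∘ τ) hψτ)).trans ?_
  refine meHausdorffDist_le_add hτ (fun _ => measurable_of_mem_lipComp hφ.1)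
    (fun _ => measurable_of_mem_lipComp hψ.1) (lipComp_comp ψ τ) ?_ ?_
  · rintro _ ⟨f, hf, rfl⟩
    -- `Function.extend` only makes `f` a function on `X`, as McShane's theorem asks; its value `0`
    -- off `S` plays no role.
    obtain ⟨g, hg, hgf⟩ := LipschitzOnWith.extend_real (f := Function.extend Subtype.val f 0)
      (s := S) (K := 1) (by
        intro x hx y hy
        have hext (z : S) : Function.extend Subtype.val f 0 (z : X) = f z :=
          Subtype.val_injective.extend_apply f 0 z
        rw [hext ⟨x, hx⟩, hext ⟨y, hy⟩]
        exact hf ⟨x, hx⟩ ⟨y, hy⟩)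
    have hgS (y : S) : g y = f y := by
      rw [← hgf y.2, Subtype.val_injective.extend_apply]
    refine ⟨g ∘ χ, ⟨g, hg, rfl⟩, ?_⟩
    have hclose := meDist_comp_le_of_lift hp hχ hlift hη hεη hμ hg
    simp only [hgS] at hclose
    exact hclose
  · rintro _ ⟨f, hf, rfl⟩
    exact ⟨(fun y : S => f y) ∘ φ, ⟨_, fun y z => hf y z, rfl⟩,
      meDist_comp_le_of_lift hp hχ hlift hη hεη hμ hf⟩

theorem mainTheorem9
    -- the complete separable smooth Riemannian manifolds `N n`, of dimension `d n`, with the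
    -- geodesic distance
    (d : ℕ → ℕ) (N : ℕ → Type*)
    [∀ n, MetricSpace (N n)] [∀ n, CompleteSpace (N n)] [∀ n, SecondCountableTopology (N n)]
    [∀ n, MeasurableSpace (N n)] [∀ n, BorelSpace (N n)]
    [∀ n, ChartedSpace (EuclideanSpace ℝ (Fin (d n))) (N n)]
    [∀ n, IsManifold (𝓡 (d n)) ∞ (N n)]
    [∀ n, RiemannianBundle (fun x : N n => TangentSpace (𝓡 (d n)) x)]
    [∀ n, IsContMDiffRiemannianBundle (𝓡 (d n)) ∞ (EuclideanSpace ℝ (Fin (d n)))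
      (fun x : N n => TangentSpace (𝓡 (d n)) x)]
    [∀ n, IsRiemannianManifold (𝓡 (d n)) (N n)]
    -- volumes and diameters are bounded by `h`
    (h : ℝ)
    (hvol : ∀ n, riemannianVolume (d n) (N n) univ ≤ ENNReal.ofReal h)
    (hdiam : ∀ n, Metric.ediam (univ : Set (N n)) ≤ ENNReal.ofReal h)
    -- the submanifolds `M n`, a concentration locus, and the projections onto them
    (M : ∀ n, Set (N n)) (hM : ∀ n, IsEmbeddedSubmanifold (d n) (M n))
    (hloc : IsConcentrationLocus (fun n => normalizedVolume (d n) (N n)) M)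
    (proj : ∀ n, N n → M n) (hproj : ∀ n, IsNearestPointProjection (proj n))
    (hmeas : ∀ n, AEMeasurable (proj n) (normalizedVolume (d n) (N n)))
    -- the limit mm-space
    (L : Type*) [MetricSpace L] [CompleteSpace L] [SecondCountableTopology L]
    [MeasurableSpace L] [BorelSpace L] (σ : Measure L) [IsProbabilityMeasure σ]
    -- `M n`, with the push-forward measure and the restricted distance, converges to it
    (hconv : Tendsto
      (fun n => dConc (Measure.map (proj n) (normalizedVolume (d n) (N n))) σ) atTop (𝓝 0)) :
    Tendsto (fun n => dConc (normalizedVolume (d n) (N n)) σ) atTop (𝓝 0) := by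
  obtain ⟨-, ε, hε, hε0, hμ0⟩ := hloc
  set η : ℕ → ℝ≥0∞ := fun n =>
    ENNReal.ofReal (ε n) + normalizedVolume (d n) (N n) (univ \ Metric.thickening (ε n) (M n))
  have hη : Tendsto η atTop (𝓝 0) := by
    simpa using (ENNReal.tendsto_ofReal hε0).add hμ0
  refine tendsto_of_tendsto_of_tendsto_of_le_of_le tendsto_const_nhds
    (by simpa using hconv.add hη) (fun _ => zero_le) fun n => ?_
  exact dConc_le_dConc_map_add σ (hproj n) (hmeas n)
    ((ENNReal.ofReal_pos.2 (hε n)).trans_le le_self_add) le_self_add le_add_self
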